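/- A quasi-symmetric $2$-$(d,k,\lambda;s_1,s_2)$ design is a set $P$ of $d$ points with a set $\mathcal B$ of $k$-subsets of $P$ (blocks) such that every $2$-subset of $P$ lies in exactly $\lambda$ blocks and any two distinct blocks meet in exactly $s_1$ or $s_2$ points, where $s_1\neq s_2$. A finite set $\Omega$ of lines through the origin of $\mathbf R^d$ is equiangular with common angle $\kappa$ if $|(u,v)|=\kappa$ for all unit vectors $u,v$ spanning two different lines of $\Omega$. It saturates the relative bound if $\kappa^2 d<1$ and $|\Omega|=\frac{d-\kappa^2 d}{1-\kappa^2 d}$. A set $\Gamma$ of lines is incoherent if $|\Gamma|\le 2$ or $(u,v)(u,w)(v,w)>0$ for all unit vectors $u,v,w$ spanning three different lines of $\Gamma$, and $\mathrm{Inc}(\Omega)$ denotes the maximum size of an incoherent subset of $\Omega$; $\Omega$ saturates the incoherence bound $\mathrm{Inc}(\Omega)\le d$ if $\mathrm{Inc}(\Omega)=d$. Proposition. Let $i$ be a positive integer. (1) If $i\equiv 4 \pmod 8$, then there is no quasi-symmetric $2$-$(d,k,\lambda;s_1,s_2)$ design with the Family 1 parameters $$d=i(i^3+6i^2+11i+5),\quad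 k=\tfrac12 i(i^3+5i^2+7i+1),\quad \lambda=\tfrac14 i(i+2)(i^2+2i-1)(i^3+5i^2+7i+1),$$ $$s_1=\tfrac14 i(i+2)(i+1)^2,\quad s_2=\tfrac14 i(i^3+4i^2+3i-4).$$ (2) If $i\equiv 2\pmod 4$, then there is no quasi-symmetric $2$-$(d,k,\lambda;s_1,s_2)$ design with the Family 2 parameters $$d=2i(2i+1),\quad k=i(2i+1),\quad \lambda=i(2i-1)(i+1),\quad s_1=i^2+i,\quad s_2=i^2.$$ (3) If $i\equiv 4\pmod 8$, $d=i(i^3+6i^2+11i+5)$, and $\Omega$ is a set of equiangular lines in $\mathbf R^d$ with common angle $\kappa=1/(i^2+3i+1)$ that saturates the relative bound, then $\mathrm{Inc}(\Omega)<d$, that is, $\Omega$ does not saturate the incoherence bound. -/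

import Mathlib

/-- A `t`-`(n, k, lam)` design: a point set `P` of size `n` with a set `B` of `k`-subsets
(blocks), such that every `t`-subset of `P` lies in exactly `lam` blocks. -/
structure IsDesign {P : Type*} [Fintype P] [DecidableEq P] (B : Finset (Finset P))
    (t n k lam : ℕ) : Prop where
  card_points : Fintype.card P = n
  card_block : ∀ b ∈ B, b.card = k
  balanced : ∀ T : Finset P, T.card = t → (B.filter (fun b => T ⊆ b)).card = lam

/-- A quasi-symmetric `t`-`(n, k, lam; s₁, s₂)` design: a design and two distinct numbers
`s₁`, `s₂` such that any two distinct blocks have exactly `s₁` or `s₂` points in common.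
It is not demanded that both numbers occur, so a non-existence claim for this notion covers the
version in which both are demanded to occur. -/
structure IsQuasiSymmetricDesign {P : Type*} [Fintype P] [DecidableEq P]
    (B : Finset (Finset P)) (t n k lam s₁ s₂ : ℕ) : Prop where
  isDesign : IsDesign B t n k lam
  ne : s₁ ≠ s₂
  inter : ∀ b ∈ B, ∀ c ∈ B, b ≠ c → (b ∩ c).card = s₁ ∨ (b ∩ c).card = s₂

/-- The natural numbers `d, k, lam, s₁, s₂` are the Family 1 parameters at `i`
(the equations are between rational numbers, so nothing is rounded or truncated). -/
def IsFamily1 (i d k lam s₁ s₂ : ℕ) : Prop :=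
  (d : ℚ) = i * ((i : ℚ) ^ 3 + 6 * (i : ℚ) ^ 2 + 11 * i + 5) ∧
  (k : ℚ) = 1 / 2 * i * ((i : ℚ) ^ 3 + 5 * (i : ℚ) ^ 2 + 7 * i + 1) ∧
  (lam : ℚ) = 1 / 4 * i * (i + 2) * ((i : ℚ) ^ 2 + 2 * i - 1) *
    ((i : ℚ) ^ 3 + 5 * (i : ℚ) ^ 2 + 7 * i + 1) ∧
  (s₁ : ℚ) = 1 / 4 * i * (i + 2) * ((i : ℚ) + 1) ^ 2 ∧
  (s₂ : ℚ) = 1 / 4 * i * ((i : ℚ) ^ 3 + 4 * (i : ℚ) ^ 2 + 3 * i - 4)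

/-- The natural numbers `d, k, lam, s₁, s₂` are the Family 2 parameters at `i`. -/
def IsFamily2 (i d k lam s₁ s₂ : ℕ) : Prop :=
  (d : ℚ) = 2 * i * (2 * i + 1) ∧
  (k : ℚ) = i * (2 * i + 1) ∧
  (lam : ℚ) = i * (2 * i - 1) * (i + 1) ∧
  (s₁ : ℚ) = (i : ℚ) ^ 2 + i ∧
  (s₂ : ℚ) = (i : ℚ) ^ 2

/-- `Ω` is a set of equiangular lines (one-dimensional subspaces) of `ℝ^d` with common
angle `κ`: the inner product of unit vectors spanning two different lines is `±κ`. -/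
structure IsEquiangular {d : ℕ} (Ω : Finset (Submodule ℝ (EuclideanSpace ℝ (Fin d))))
    (κ : ℝ) : Prop where
  isLine : ∀ L ∈ Ω, Module.finrank ℝ L = 1
  angle : ∀ L ∈ Ω, ∀ M ∈ Ω, L ≠ M → ∀ u ∈ L, ∀ v ∈ M, ‖u‖ = 1 → ‖v‖ = 1 →
    |inner ℝ u v| = κ

/-- A set of lines is incoherent if it has at most two elements, or if for any three different
lines in it the product of the three inner products of representing unit vectors is positive
(this product does not depend on the choice of the unit vectors). -/
def IsIncoherent {d : ℕ} (Γ : Finset (Submodule ℝ (EuclideanSpace ℝ (Fin d)))) : Prop :=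
  Γ.card ≤ 2 ∨
    ∀ L ∈ Γ, ∀ M ∈ Γ, ∀ N ∈ Γ, L ≠ M → L ≠ N → M ≠ N →
      ∀ u ∈ L, ∀ v ∈ M, ∀ w ∈ N, ‖u‖ = 1 → ‖v‖ = 1 → ‖w‖ = 1 →
        0 < inner ℝ u v * inner ℝ u w * inner ℝ v w

open Classical in
/-- `Inc(Ω)`: the maximum size of an incoherent subset of `Ω`. -/
noncomputable def incoherence {d : ℕ}
    (Ω : Finset (Submodule ℝ (EuclideanSpace ℝ (Fin d)))) : ℕ :=
  (Ω.powerset.filter IsIncoherent).sup Finset.card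

/-- A set `Ω` of lines of `ℝ^d` with common angle `κ` saturates the relative bound:
`κ² d < 1` and `|Ω| = (d - κ² d) / (1 - κ² d)`. -/
def SaturatesRelativeBound {d : ℕ} (Ω : Finset (Submodule ℝ (EuclideanSpace ℝ (Fin d))))
    (κ : ℝ) : Prop :=
  κ ^ 2 * d < 1 ∧ (Ω.card : ℝ) = (d - κ ^ 2 * d) / (1 - κ ^ 2 * d)

/-! All three claims reduce to one fact, `eight_dvd_card_of_even_design`: for an even number `n` of
points, even block sizes and intersections, even `r` and `lam`, and `r - lam = 4ρ` with `ρ` odd, `8`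
divides `n`. In every case at hand `d ≡ 4` modulo `8`.

Let `ζ` be the primitive 16th root of unity given by `ZMod.stdAddChar`, and `Q(z) = ∑ (z_p² - 2
z_p)` on `(ℤ/16)^n`. The Gauss sum `∑ ζ^Q(z)` factors over the points and equals `32^(n/2) ζ^n`. Let
`K` be generated by twice the indicators of the blocks and of the whole point set. Even
intersections make `Q` vanish on `K`, so averaging over translates by `K` leaves only those `z`
whose sums over all blocks and over all points are `0` modulo `4`. For such `z`, counting incidences
gives `8 ∣ ∑ z_p²`, hence `Q(z) ∈ {0, 8}`. The Gauss sum is therefore real, so `ζ^n = ζ^(-n)` and `8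
∣ n`.

For the lines, an incoherent `d`-subset yields a basis of unit vectors with all inner products `κ`.
Each remaining line has inner products `±κ` with this basis, that is, a sign vector. Equality in the
relative bound makes the lines a tight frame, which forces the positive supports of the sign vectors
to be blocks with the Family 1 values of `r` and `lam` and even intersections; the same fact
applies. -/

/-! ### Gauss sums modulo 16. -/

lemma stdAddChar_eight : ZMod.stdAddChar (8 : ZMod 16) = -1 := by
  have h1 : ZMod.stdAddChar (8 : ZMod 16) * ZMod.stdAddChar (8 : ZMod 16) = 1 := by
    rw [← AddChar.map_add_eq_mul]
    have : (8 + 8 : ZMod 16) = 0 := by decide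
    rw [this, AddChar.map_zero_eq_one]
  rcases mul_self_eq_one_iff.mp h1 with h | h
  · have h2 : ZMod.stdAddChar (8 : ZMod 16) = ZMod.stdAddChar (0 : ZMod 16) := by
      rw [h, AddChar.map_zero_eq_one]
    exact absurd (ZMod.injective_stdAddChar h2) (by decide)
  · exact h

/-- The quadratic Gauss sum modulo `16` of `z ^ 2 - 2 z`, squared. -/
lemma sq_sum_stdAddChar :
    (∑ z : ZMod 16, ZMod.stdAddChar (z * z - 2 * z)) ^ 2 = 32 * ZMod.stdAddChar (2 : ZMod 16) := by
  -- Here `z² - 2z = (z - 1)² - 1` takes each of the values `-1, 3, 0, 8` four times, and the values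
  -- `0` and `8` cancel.
  have hs : ∑ z : ZMod 16, ZMod.stdAddChar (z * z - 2 * z) =
      4 * (ZMod.stdAddChar (-1 : ZMod 16) + ZMod.stdAddChar (3 : ZMod 16)) := by
    have hset : (Finset.univ : Finset (ZMod 16)) =
        {0, 1, 2, 3, 4, 5, 6, 7, 8, 9, 10, 11, 12, 13, 14, 15} := by decide
    have hv : ∀ z w : ZMod 16, z * z - 2 * z = w →
        ZMod.stdAddChar (z * z - 2 * z) = ZMod.stdAddChar w := fun z w h => by rw [h]
    rw [hset]
    repeat rw [Finset.sum_insert (by decide)]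
    rw [Finset.sum_singleton, hv 0 0 (by decide), hv 1 (-1) (by decide), hv 2 0 (by decide),
      hv 3 3 (by decide), hv 4 8 (by decide), hv 5 (-1) (by decide), hv 6 8 (by decide),
      hv 7 3 (by decide), hv 8 0 (by decide), hv 9 (-1) (by decide), hv 10 0 (by decide),
      hv 11 3 (by decide), hv 12 8 (by decide), hv 13 (-1) (by decide), hv 14 8 (by decide),
      hv 15 3 (by decide), stdAddChar_eight, AddChar.map_zero_eq_one]
    ring
  have h1 : ZMod.stdAddChar (3 : ZMod 16) * ZMod.stdAddChar (-1 : ZMod 16) =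
      ZMod.stdAddChar (2 : ZMod 16) := by
    rw [← AddChar.map_add_eq_mul]; congr 1
  -- Since `ζ^6 = -ζ^(-2)`, the two outer terms of `(ζ^(-1) + ζ^3)²` cancel and `2ζ^2` remains.
  have h2 : ZMod.stdAddChar (3 : ZMod 16) * ZMod.stdAddChar (3 : ZMod 16) =
      ZMod.stdAddChar (-2 : ZMod 16) * ZMod.stdAddChar (8 : ZMod 16) := by
    rw [← AddChar.map_add_eq_mul, ← AddChar.map_add_eq_mul]; congr 1
  have h3 : ZMod.stdAddChar (-1 : ZMod 16) * ZMod.stdAddChar (-1 : ZMod 16) =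
      ZMod.stdAddChar (-2 : ZMod 16) := by
    rw [← AddChar.map_add_eq_mul]; congr 1
  rw [stdAddChar_eight] at h2
  rw [hs]
  linear_combination 32 * h1 + 16 * h2 + 16 * h3

section GaussSum

variable {P : Type*} [Fintype P]

/-- The quadratic form `∑ (z ^ 2 - 2 z)` modulo `16`. -/
def shiftedSq (z : P → ZMod 16) : ZMod 16 := ∑ p, (z p * z p - 2 * z p)

lemma shiftedSq_add (z x : P → ZMod 16) :
    shiftedSq (z + x) = shiftedSq z + shiftedSq x + 2 * ∑ p, x p * z p := by
  simp only [shiftedSq, Pi.add_apply, Finset.mul_sum, ← Finset.sum_add_distrib]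
  exact Finset.sum_congr rfl fun p _ => by ring

lemma sum_stdAddChar_shiftedSq [DecidableEq P] :
    ∑ z : P → ZMod 16, ZMod.stdAddChar (shiftedSq z) =
      (∑ z : ZMod 16, ZMod.stdAddChar (z * z - 2 * z)) ^ Fintype.card P := by
  have h : ∀ z : P → ZMod 16, ZMod.stdAddChar (shiftedSq z) =
      ∏ p, ZMod.stdAddChar (z p * z p - 2 * z p) := fun z => by
    rw [shiftedSq]
    exact map_prod ZMod.stdAddChar.toMonoidHom
      (fun p => Multiplicative.ofAdd (z p * z p - 2 * z p)) Finset.univ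
  simp only [h]
  rw [← Finset.card_univ, ← Finset.prod_const, Finset.prod_univ_sum, Fintype.piFinset_univ]

/-- If `shiftedSq` vanishes on a subgroup `K`, the Gauss sum only sees the orthogonal of `K`. -/
lemma sum_stdAddChar_shiftedSq_eq_sum_orthogonal [DecidableEq P] (K : AddSubgroup (P → ZMod 16))
    (hK : ∀ x ∈ K, shiftedSq x = 0) :
    ∑ z : P → ZMod 16, ZMod.stdAddChar (shiftedSq z) =
      ∑ z : P → ZMod 16, open Classical in
        if ∀ x ∈ K, 2 * ∑ p, x p * z p = 0 then ZMod.stdAddChar (shiftedSq z) else 0 := by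
  classical
  have hcard : (Fintype.card K : ℂ) ≠ 0 := by exact_mod_cast Fintype.card_ne_zero
  apply mul_left_cancel₀ hcard
  -- Translation by `x ∈ K` permutes the summands; adding up all translates produces, for each `z`,
  -- a character sum over `K`.
  have h1 : (Fintype.card K : ℂ) * ∑ z : P → ZMod 16, ZMod.stdAddChar (shiftedSq z) =
      ∑ x : K, ∑ z : P → ZMod 16, ZMod.stdAddChar (shiftedSq (z + (x : P → ZMod 16))) := by
    have : ∀ x : K, ∑ z : P → ZMod 16, ZMod.stdAddChar (shiftedSq (z + (x : P → ZMod 16))) =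
        ∑ z : P → ZMod 16, ZMod.stdAddChar (shiftedSq z) := fun x =>
      Equiv.sum_comp (Equiv.addRight (x : P → ZMod 16))
        (fun z => ZMod.stdAddChar (shiftedSq z))
    simp [this]
  rw [h1, Finset.sum_comm, Finset.mul_sum]
  refine Finset.sum_congr rfl fun z _ => ?_
  let ψ : AddChar K ℂ :=
    { toFun := fun x => ZMod.stdAddChar (2 * ∑ p, (x : P → ZMod 16) p * z p)
      map_zero_eq_one' := by simp
      map_add_eq_mul' := fun x y => by
        rw [← AddChar.map_add_eq_mul]
        congr 1
        simp [add_mul, Finset.sum_add_distrib, mul_add] }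
  have h2 : ∀ x : K, ZMod.stdAddChar (shiftedSq (z + (x : P → ZMod 16))) =
      ZMod.stdAddChar (shiftedSq z) * ψ x := fun x => by
    rw [shiftedSq_add, hK x x.2, add_zero, AddChar.map_add_eq_mul]; rfl
  simp only [h2]
  rw [← Finset.mul_sum, AddChar.sum_eq_ite]
  have h3 : ψ = 0 ↔ ∀ x ∈ K, 2 * ∑ p, x p * z p = 0 := by
    rw [DFunLike.ext_iff]
    constructor
    · intro h x hx
      apply ZMod.injective_stdAddChar
      rw [AddChar.map_zero_eq_one]
      exact h ⟨x, hx⟩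
    · intro h x
      change ZMod.stdAddChar (2 * ∑ p, (x : P → ZMod 16) p * z p) = 1
      rw [h x x.2, AddChar.map_zero_eq_one]
  by_cases h : ψ = 0
  · rw [if_pos h, if_pos (h3.mp h)]; ring
  · rw [if_neg h, if_neg (fun h' => h (h3.mpr h'))]; ring

/-- A self-orthogonal subgroup on whose orthogonal complement `shiftedSq` only takes the values
`0` and `8` exists only in dimensions divisible by `8`. -/
lemma eight_dvd_card_of_orthogonal [DecidableEq P] (hP : Even (Fintype.card P))
    (K : AddSubgroup (P → ZMod 16)) (hK : ∀ x ∈ K, shiftedSq x = 0)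
    (hK' : ∀ z : P → ZMod 16, (∀ x ∈ K, 2 * ∑ p, x p * z p = 0) → 2 * shiftedSq z = 0) :
    8 ∣ Fintype.card P := by
  classical
  obtain ⟨u, hu⟩ := hP
  have hS : ∑ z : P → ZMod 16, ZMod.stdAddChar (shiftedSq z) =
      32 ^ u * ZMod.stdAddChar ((Fintype.card P : ℕ) : ZMod 16) := by
    rw [sum_stdAddChar_shiftedSq, hu, ← two_mul, pow_mul, sq_sum_stdAddChar, mul_pow,
      ← AddChar.map_nsmul_eq_pow]
    congr 2
    simp [mul_comm]
  -- Each surviving term is fixed by conjugation, because `2 * shiftedSq z = 0` means `-shiftedSq z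
  -- = shiftedSq z`.
  have hreal : (starRingEnd ℂ) (∑ z : P → ZMod 16, ZMod.stdAddChar (shiftedSq z)) =
      ∑ z : P → ZMod 16, ZMod.stdAddChar (shiftedSq z) := by
    rw [sum_stdAddChar_shiftedSq_eq_sum_orthogonal K hK, map_sum]
    refine Finset.sum_congr rfl fun z _ => ?_
    split_ifs with h
    · rw [← AddChar.map_neg_eq_conj]
      congr 1
      linear_combination -hK' z h
    · simp
  rw [hS, map_mul, ← AddChar.map_neg_eq_conj, map_pow, map_ofNat] at hreal
  have h4 := ZMod.injective_stdAddChar (mul_left_cancel₀ (pow_ne_zero u (by norm_num)) hreal)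
  have h5 : ((2 * Fintype.card P : ℕ) : ZMod 16) = 0 := by
    push_cast
    linear_combination -h4
  rw [ZMod.natCast_eq_zero_iff] at h5
  omega

end GaussSum

/-! ### Divisibility by 8 for even designs. -/

section EvenDesign

variable {ι P : Type*} [Fintype ι] [Fintype P] [DecidableEq P]

lemma sum_sum_mem_of_regular {B : ι → Finset P} {r : ℕ}
    (hr : ∀ p, (Finset.univ.filter fun w => p ∈ B w).card = r) (Z : P → ℤ) :
    ∑ w, ∑ p ∈ B w, Z p = r * ∑ p, Z p := by
  have h : ∀ w, ∑ p ∈ B w, Z p = ∑ p, if p ∈ B w then Z p else 0 := fun w => by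
    rw [Finset.sum_ite_mem, Finset.univ_inter]
  simp only [h]
  rw [Finset.sum_comm, Finset.mul_sum]
  refine Finset.sum_congr rfl fun p _ => ?_
  rw [← Finset.sum_filter, Finset.sum_const, hr, nsmul_eq_mul]

/-- Expand the square over ordered pairs of points: a diagonal pair is counted `r` times, any other
pair `lam` times. -/
lemma sum_sq_sum_mem_of_balanced {B : ι → Finset P} {r lam : ℕ}
    (hr : ∀ p, (Finset.univ.filter fun w => p ∈ B w).card = r)
    (hlam : ∀ p q, p ≠ q → (Finset.univ.filter fun w => p ∈ B w ∧ q ∈ B w).card = lam)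
    (Z : P → ℤ) :
    ∑ w, (∑ p ∈ B w, Z p) ^ 2 = (r - lam) * ∑ p, Z p ^ 2 + lam * (∑ p, Z p) ^ 2 := by
  have h : ∀ w, (∑ p ∈ B w, Z p) ^ 2 =
      ∑ p, ∑ q, if p ∈ B w ∧ q ∈ B w then Z p * Z q else 0 := fun w => by
    have h1 : ∑ p ∈ B w, Z p = ∑ p, if p ∈ B w then Z p else 0 := by
      rw [Finset.sum_ite_mem, Finset.univ_inter]
    rw [h1, sq, Finset.sum_mul_sum]
    refine Finset.sum_congr rfl fun p _ => Finset.sum_congr rfl fun q _ => ?_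
    by_cases hp : p ∈ B w <;> by_cases hq : q ∈ B w <;> simp [hp, hq]
  have h2 : ∀ p q, (∑ w, if p ∈ B w ∧ q ∈ B w then Z p * Z q else 0) =
      (if p = q then (r - lam : ℤ) * (Z p * Z q) else 0) + lam * (Z p * Z q) := by
    intro p q
    rw [← Finset.sum_filter, Finset.sum_const, nsmul_eq_mul]
    by_cases hpq : p = q
    · subst hpq
      simp only [and_self, hr, if_true]
      ring
    · rw [hlam p q hpq, if_neg hpq, zero_add]
  simp only [h]
  rw [Finset.sum_comm]
  simp only [Finset.sum_comm (s := (Finset.univ : Finset ι)), h2, Finset.sum_add_distrib,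
    Finset.sum_ite_eq, Finset.mem_univ, if_true]
  rw [sq (∑ p, Z p), Finset.sum_mul_sum, Finset.mul_sum, Finset.mul_sum]
  congr 1
  · exact Finset.sum_congr rfl fun p _ => by ring
  · exact Finset.sum_congr rfl fun p _ => by rw [Finset.mul_sum]

/-- The vector with entries `2` on `T` and `0` elsewhere. -/
def doubleIndicator (T : Finset P) (p : P) : ZMod 16 := if p ∈ T then 2 else 0

lemma sum_doubleIndicator_mul (T : Finset P) (z : P → ZMod 16) :
    ∑ p, doubleIndicator T p * z p = 2 * ∑ p ∈ T, z p := by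
  rw [Finset.mul_sum, ← Finset.univ_inter T, ← Finset.sum_ite_mem, Finset.univ_inter]
  exact Finset.sum_congr rfl fun p _ => by by_cases h : p ∈ T <;> simp [doubleIndicator, h]

/-- The shift `-2z` makes the form vanish on the generators, since `z² - 2z` is `0` at both `0` and
`2`. The polar form of two generators is `8 |S ∩ T|`, which is `0` modulo `16`, so vanishing passes
to sums and negatives. -/
lemma shiftedSq_eq_zero_of_mem_closure {𝒯 : Set (Finset P)}
    (h𝒯 : ∀ S ∈ 𝒯, ∀ T ∈ 𝒯, Even (S ∩ T).card) {x : P → ZMod 16}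
    (hx : x ∈ AddSubgroup.closure (doubleIndicator '' 𝒯)) : shiftedSq x = 0 := by
  have h1 : ∀ T ∈ 𝒯, ∀ x ∈ AddSubgroup.closure (doubleIndicator '' 𝒯),
      2 * ∑ p, doubleIndicator T p * x p = 0 := by
    intro T hT x hx
    induction hx using AddSubgroup.closure_induction with
    | mem x hx =>
      obtain ⟨S, hS, rfl⟩ := hx
      obtain ⟨u, hu⟩ := h𝒯 T hT S hS
      have h : ∑ p ∈ T, doubleIndicator S p = 2 * ((T ∩ S).card : ZMod 16) := by
        simp only [doubleIndicator]
        rw [Finset.sum_ite_mem, Finset.sum_const, nsmul_eq_mul, mul_comm]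
      rw [sum_doubleIndicator_mul, h, hu]
      push_cast
      have h16 : (16 : ZMod 16) = 0 := by decide
      linear_combination (u : ZMod 16) * h16
    | zero => simp
    | add x y _ _ hx hy =>
      simp only [Pi.add_apply, mul_add, Finset.sum_add_distrib]
      rw [hx, hy, add_zero]
    | neg x _ hx =>
      simp only [Pi.neg_apply, mul_neg, Finset.sum_neg_distrib]
      rw [hx, neg_zero]
  have h2 : ∀ y ∈ AddSubgroup.closure (doubleIndicator '' 𝒯),
      ∀ x ∈ AddSubgroup.closure (doubleIndicator '' 𝒯), 2 * ∑ p, y p * x p = 0 := by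
    intro y hy x hx
    induction hy using AddSubgroup.closure_induction with
    | mem y hy =>
      obtain ⟨S, hS, rfl⟩ := hy
      exact h1 S hS x hx
    | zero => simp
    | add y y' _ _ hy hy' =>
      simp only [Pi.add_apply, add_mul, Finset.sum_add_distrib, mul_add]
      rw [hy, hy', add_zero]
    | neg y _ hy =>
      simp only [Pi.neg_apply, neg_mul, mul_neg, Finset.sum_neg_distrib]
      rw [hy, neg_zero]
  have h0 : shiftedSq (0 : P → ZMod 16) = 0 := by simp [shiftedSq]
  induction hx using AddSubgroup.closure_induction with
  | mem x hx =>
    obtain ⟨S, hS, rfl⟩ := hx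
    refine Finset.sum_eq_zero fun p _ => ?_
    by_cases h : p ∈ S <;> simp [doubleIndicator, h]
  | zero => exact h0
  | add x y hx hy hx' hy' => rw [shiftedSq_add, hx', hy', h2 y hy x hx]; simp
  | neg x hx hx' =>
    have h := shiftedSq_add x (-x)
    rw [add_neg_cancel, h0, hx', h2 (-x) (neg_mem hx) x hx] at h
    simpa using h.symm

/-- A design with even block sizes, even block intersections, an even number of points, `r` and
`lam` even and `r - lam` congruent to `4` modulo `8` has a number of points divisible by `8`. -/
theorem eight_dvd_card_of_even_design (B : ι → Finset P) {r lam : ℕ}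
    (hr : ∀ p, (Finset.univ.filter fun w => p ∈ B w).card = r)
    (hlam : ∀ p q, p ≠ q → (Finset.univ.filter fun w => p ∈ B w ∧ q ∈ B w).card = lam)
    (hB : ∀ w w', Even (B w ∩ B w').card) (hP : Even (Fintype.card P))
    (hr2 : Even r) (hlam2 : Even lam) {ρ : ℤ} (hρ : Odd ρ) (hrl : (r : ℤ) - lam = 4 * ρ) :
    8 ∣ Fintype.card P := by
  -- The full point set is included so that orthogonality also controls `∑ z`, which occurs in
  -- `shiftedSq`.
  let 𝒯 : Set (Finset P) := insert Finset.univ (Set.range B)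
  have hBk : ∀ w, Even (B w).card := fun w => by simpa using hB w w
  have h𝒯 : ∀ S ∈ 𝒯, ∀ T ∈ 𝒯, Even (S ∩ T).card := by
    rintro S (rfl | ⟨w, rfl⟩) T (rfl | ⟨w', rfl⟩)
    · simpa using hP
    · simpa using hBk w'
    · simpa using hBk w
    · exact hB w w'
  refine eight_dvd_card_of_orthogonal hP (AddSubgroup.closure (doubleIndicator '' 𝒯))
    (fun x hx => shiftedSq_eq_zero_of_mem_closure h𝒯 hx) fun z hz => ?_
  -- Integer lifts are used because the counting identities will be divided by `4`.
  let Z : P → ℤ := fun p => ((z p).val : ℤ)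
  have hZ : ∀ p, ((Z p : ℤ) : ZMod 16) = z p := fun p => by simp [Z]
  have h4 : ∀ T ∈ 𝒯, (4 : ℤ) ∣ ∑ p ∈ T, Z p := by
    intro T hT
    have h := hz _ (AddSubgroup.subset_closure ⟨T, hT, rfl⟩)
    rw [sum_doubleIndicator_mul] at h
    have h' : ((4 * ∑ p ∈ T, Z p : ℤ) : ZMod 16) = 0 := by
      push_cast
      simp only [hZ]
      linear_combination h
    rw [ZMod.intCast_zmod_eq_zero_iff_dvd] at h'
    omega
  have h5 : ∀ w, (4 : ℤ) ∣ ∑ p ∈ B w, Z p := fun w => h4 _ (Or.inr ⟨w, rfl⟩)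
  choose m hm using h5
  obtain ⟨t, ht⟩ := h4 _ (Or.inl rfl)
  have e1 := sum_sum_mem_of_regular hr Z
  have e2 := sum_sq_sum_mem_of_balanced hr hlam Z
  simp only [hm, ht] at e1 e2
  obtain ⟨r', rfl⟩ := hr2
  obtain ⟨l', rfl⟩ := hlam2
  obtain ⟨ρ', rfl⟩ := hρ
  -- As `m² ≡ m` modulo `2` and `∑ m = r t` is even, `∑ m²` is even, which supplies the last factor
  -- `2` in `8 ∣ ∑ Z²`.
  have hpar : (2 : ℤ) ∣ ∑ w, m w ^ 2 - ∑ w, m w := by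
    rw [← Finset.sum_sub_distrib]
    refine Finset.dvd_sum fun w _ => ?_
    have := Int.even_mul_pred_self (m w)
    rw [show m w ^ 2 - m w = m w * (m w - 1) by ring]
    exact this.two_dvd
  obtain ⟨c, hc⟩ := hpar
  have e1' : ∑ w, m w = 2 * (r' * t) := by
    rw [← Finset.mul_sum] at e1
    push_cast at e1
    linarith
  have e2' : 4 * ∑ w, m w ^ 2 = (2 * ρ' + 1) * ∑ p, Z p ^ 2 + 8 * (l' * t ^ 2) := by
    simp only [mul_pow] at e2
    rw [← Finset.mul_sum, hrl] at e2
    push_cast at e2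
    linarith
  have h8 : (8 : ℤ) ∣ ∑ p, Z p ^ 2 := by
    have hcop : IsCoprime (8 : ℤ) (2 * ρ' + 1) := by
      have : IsCoprime (2 : ℤ) (2 * ρ' + 1) := ⟨-ρ', 1, by ring⟩
      exact (this.pow_left (m := 3))
    refine hcop.dvd_of_dvd_mul_left ⟨c + r' * t - l' * t ^ 2, ?_⟩
    linarith
  obtain ⟨s, hs⟩ := h8
  have hfin : shiftedSq z = ((∑ p, Z p ^ 2 - 2 * ∑ p, Z p : ℤ) : ZMod 16) := by
    push_cast
    simp only [hZ, shiftedSq, Finset.mul_sum, ← Finset.sum_sub_distrib, sq]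
  rw [hfin, hs, ht]
  push_cast
  have h16 : (16 : ZMod 16) = 0 := by decide
  linear_combination ((s : ZMod 16) - t) * h16

end EvenDesign

/-! ### The two families of quasi-symmetric designs. -/

section QuasiSymmetric

variable {P : Type*} [Fintype P] [DecidableEq P]

lemma IsDesign.card_filter_pair {B : Finset (Finset P)} {n k lam : ℕ}
    (h : IsDesign B 2 n k lam) {p q : P} (hpq : p ≠ q) :
    (B.filter fun b => p ∈ b ∧ q ∈ b).card = lam := by
  rw [← h.balanced {p, q} (Finset.card_pair hpq)]
  congr 1
  exact Finset.filter_congr fun b _ => by simp [Finset.insert_subset_iff]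

/-- Double count the pairs `(q, b)` with `q ≠ p` and `p, q ∈ b`. This determines the replication
number as soon as `k ≠ 1`. -/
lemma IsDesign.card_filter_mem_mul {B : Finset (Finset P)} {n k lam : ℕ}
    (h : IsDesign B 2 n k lam) (p : P) :
    ((B.filter fun b => p ∈ b).card : ℤ) * (k - 1) = lam * (n - 1) := by
  have h1 : ∑ q, (B.filter fun b => p ∈ b ∧ q ∈ b).card =
      (B.filter fun b => p ∈ b).card * k := by
    have h2 : ∀ q, (B.filter fun b => p ∈ b ∧ q ∈ b).card =
        ∑ b ∈ B.filter (fun b => p ∈ b), if q ∈ b then 1 else 0 := fun q => by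
      rw [Finset.sum_boole, Finset.filter_filter, Nat.cast_id]
    simp only [h2]
    rw [Finset.sum_comm, Finset.sum_const_nat]
    intro b hb
    rw [Finset.sum_boole, Finset.filter_univ_mem, Nat.cast_id]
    exact h.card_block b (Finset.mem_filter.mp hb).1
  rw [← Finset.add_sum_erase _ _ (Finset.mem_univ p)] at h1
  have h3 : ∑ q ∈ Finset.univ.erase p, (B.filter fun b => p ∈ b ∧ q ∈ b).card =
      (n - 1) * lam := by
    rw [Finset.sum_const_nat (m := lam), Finset.card_erase_of_mem (Finset.mem_univ p),
      Finset.card_univ, h.card_points]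
    intro q hq
    exact h.card_filter_pair (Finset.ne_of_mem_erase hq).symm
  have hn : 1 ≤ n := by
    rw [← h.card_points]
    exact Fintype.card_pos_iff.mpr ⟨p⟩
  rw [h3] at h1
  simp only [and_self] at h1
  zify [hn] at h1
  linarith

/-- A quasi-symmetric design with even parameters and `r - lam` congruent to `4` modulo `8` has a
number of points divisible by `8`. -/
theorem IsQuasiSymmetricDesign.eight_dvd {B : Finset (Finset P)} {n k lam s₁ s₂ : ℕ}
    (h : IsQuasiSymmetricDesign B 2 n k lam s₁ s₂) (hn : Even n) (hk : Even k) (hlam : Even lam)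
    (hs₁ : Even s₁) (hs₂ : Even s₂) {R ρ : ℤ} (hR : R * (k - 1) = lam * (n - 1)) (hR2 : Even R)
    (hρ : Odd ρ) (hRl : R - lam = 4 * ρ) : 8 ∣ n := by
  rcases isEmpty_or_nonempty P with hP | ⟨⟨p₀⟩⟩
  · rw [← h.isDesign.card_points, Fintype.card_eq_zero]
    exact dvd_zero 8
  have hk1 : (k : ℤ) - 1 ≠ 0 := by
    obtain ⟨u, rfl⟩ := hk
    omega
  have hr : ∀ p, ((B.filter fun b => p ∈ b).card : ℤ) = R := fun p =>
    mul_right_cancel₀ hk1 ((h.isDesign.card_filter_mem_mul p).trans hR.symm)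
  -- A point is needed here: `R` is nonnegative because it counts the blocks through `p₀`.
  lift R to ℕ using by rw [← hr p₀]; positivity
  rw [← h.isDesign.card_points] at hn ⊢
  have hsub : ∀ q : Finset P → Prop, ∀ [DecidablePred q],
      (Finset.univ.filter fun b : B => q b).card = (B.filter q).card := fun q _ => by
    rw [← Finset.card_map (Function.Embedding.subtype _)]
    congr 1
    ext b
    simp [and_comm]
  refine eight_dvd_card_of_even_design (fun b : B => (b : Finset P)) (r := R) (lam := lam)
    (fun p => ?_) (fun p q hpq => ?_) ?_ hn (by exact_mod_cast hR2) hlam hρ hRl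
  · rw [hsub fun b => p ∈ b]
    exact_mod_cast hr p
  · rw [hsub fun b => p ∈ b ∧ q ∈ b]
    exact h.isDesign.card_filter_pair hpq
  · rintro ⟨b, hb⟩ ⟨c, hc⟩
    by_cases hbc : b = c
    · subst hbc
      simpa [h.isDesign.card_block b hb] using hk
    · rcases h.inter b hb c hc hbc with h' | h' <;> simpa [h']

theorem not_isQuasiSymmetricDesign_of_isFamily1 {i d k lam s₁ s₂ : ℕ} (hi : i ≡ 4 [MOD 8])
    (hF : IsFamily1 i d k lam s₁ s₂) (B : Finset (Finset P)) :
    ¬ IsQuasiSymmetricDesign B 2 d k lam s₁ s₂ := by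
  intro h
  obtain ⟨m, rfl⟩ : ∃ m, i = 8 * m + 4 := ⟨i / 8, by unfold Nat.ModEq at hi; omega⟩
  obtain ⟨hd, hk, hl, h1, h2⟩ := hF
  push_cast at hd hk hl h1 h2
  set K : ℤ := (8 * m + 4) ^ 3 + 5 * (8 * m + 4) ^ 2 + 7 * (8 * m + 4) + 1 with hK
  have hd' : (d : ℤ) =
      (8 * m + 4) * ((8 * m + 4) ^ 3 + 6 * (8 * m + 4) ^ 2 + 11 * (8 * m + 4) + 5) := by
    exact_mod_cast hd
  have hk' : (k : ℤ) = (4 * m + 2) * K := by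
    have : (k : ℚ) = ((4 * m + 2) * K : ℤ) := by rw [hk, hK]; push_cast; ring
    exact_mod_cast this
  have hl' : (lam : ℤ) = (2 * m + 1) * (8 * m + 6) * ((8 * m + 4) ^ 2 + 2 * (8 * m + 4) - 1) * K := by
    have : (lam : ℚ) = ((2 * m + 1) * (8 * m + 6) *
        ((8 * m + 4) ^ 2 + 2 * (8 * m + 4) - 1) * K : ℤ) := by
      rw [hl, hK]; push_cast; ring
    exact_mod_cast this
  have h1' : (s₁ : ℤ) = (2 * m + 1) * (8 * m + 6) * (8 * m + 5) ^ 2 := by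
    have : (s₁ : ℚ) = ((2 * m + 1) * (8 * m + 6) * (8 * m + 5) ^ 2 : ℤ) := by
      rw [h1]; push_cast; ring
    exact_mod_cast this
  have h2' : (s₂ : ℤ) =
      (2 * m + 1) * ((8 * m + 4) ^ 3 + 4 * (8 * m + 4) ^ 2 + 3 * (8 * m + 4) - 4) := by
    have : (s₂ : ℚ) = ((2 * m + 1) *
        ((8 * m + 4) ^ 3 + 4 * (8 * m + 4) ^ 2 + 3 * (8 * m + 4) - 4) : ℤ) := by
      rw [h2]; push_cast; ring
    exact_mod_cast this
  have hK2 : Odd K := by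
    rw [hK]
    exact ⟨(4 * m + 2) * ((8 * m + 4) ^ 2 + 5 * (8 * m + 4) + 7), by ring⟩
  have heven : ∀ {a : ℕ} {b : ℤ}, (a : ℤ) = 2 * b → Even a := fun {a b} hab => by
    rw [← Int.even_coe_nat]; exact ⟨b, by linarith⟩
  have h8 : 8 ∣ d := by
    -- `R` is `lam (d - 1) / (k - 1)` and `ρ` is `(R - lam) / 4`; with `i = 8m + 4`, `R - lam =
    -- (i/2)² (i + 3)² K`, where `i/2` is twice an odd number.
    refine h.eight_dvd (R := k * ((8 * m + 4) ^ 3 + 5 * (8 * m + 4) ^ 2 + 6 * (8 * m + 4) - 1))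
      (ρ := (2 * m + 1) ^ 2 * K * (8 * m + 7) ^ 2)
      (heven (b := (4 * m + 2) * ((8 * m + 4) ^ 3 + 6 * (8 * m + 4) ^ 2 + 11 * (8 * m + 4) + 5))
        (by rw [hd']; ring))
      (heven (b := (2 * m + 1) * K) (by rw [hk']; ring))
      (heven (b := (2 * m + 1) * (4 * m + 3) * ((8 * m + 4) ^ 2 + 2 * (8 * m + 4) - 1) * K)
        (by rw [hl']; ring))
      (heven (b := (2 * m + 1) * (4 * m + 3) * (8 * m + 5) ^ 2) (by rw [h1']; ring))
      (heven (b := (2 * m + 1) *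
        ((4 * m + 2) * ((8 * m + 4) ^ 2 + 4 * (8 * m + 4) + 3) - 2)) (by rw [h2']; ring))
      ?_ ?_ ?_ ?_
    · rw [hk', hd', hl', hK]; ring
    · rw [hk']
      exact ⟨(2 * m + 1) * K * ((8 * m + 4) ^ 3 + 5 * (8 * m + 4) ^ 2 + 6 * (8 * m + 4) - 1),
        by ring⟩
    · exact ((odd_two_mul_add_one _).pow.mul hK2).mul (Odd.pow ⟨4 * m + 3, by ring⟩)
    · rw [hk', hl', hK]; ring
  have h4 : (d : ℤ) = 8 * ((2 * m) * ((8 * m + 4) ^ 3 + 6 * (8 * m + 4) ^ 2 + 11 * (8 * m + 4) + 5)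
      - m * ((8 * m + 4) ^ 3 + 6 * (8 * m + 4) ^ 2 + 11 * (8 * m + 4) + 5) +
      ((4 * m + 2) * ((8 * m + 4) ^ 2 + 6 * (8 * m + 4) + 11) + 2)) + 4 := by
    rw [hd']; ring
  omega

theorem not_isQuasiSymmetricDesign_of_isFamily2 {i d k lam s₁ s₂ : ℕ} (hi : i ≡ 2 [MOD 4])
    (hF : IsFamily2 i d k lam s₁ s₂) (B : Finset (Finset P)) :
    ¬ IsQuasiSymmetricDesign B 2 d k lam s₁ s₂ := by
  intro h
  obtain ⟨m, rfl⟩ : ∃ m, i = 4 * m + 2 := ⟨i / 4, by unfold Nat.ModEq at hi; omega⟩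
  obtain ⟨hd, hk, hl, h1, h2⟩ := hF
  push_cast at hd hk hl h1 h2
  have hd' : (d : ℤ) = 2 * (4 * m + 2) * (8 * m + 5) := by
    have : (d : ℚ) = (2 * (4 * m + 2) * (8 * m + 5) : ℤ) := by rw [hd]; push_cast; ring
    exact_mod_cast this
  have hk' : (k : ℤ) = (4 * m + 2) * (8 * m + 5) := by
    have : (k : ℚ) = ((4 * m + 2) * (8 * m + 5) : ℤ) := by rw [hk]; push_cast; ring
    exact_mod_cast this
  have hl' : (lam : ℤ) = (4 * m + 2) * (8 * m + 3) * (4 * m + 3) := by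
    have : (lam : ℚ) = ((4 * m + 2) * (8 * m + 3) * (4 * m + 3) : ℤ) := by
      rw [hl]; push_cast; ring
    exact_mod_cast this
  have h1' : (s₁ : ℤ) = (4 * m + 2) ^ 2 + (4 * m + 2) := by exact_mod_cast h1
  have h2' : (s₂ : ℤ) = (4 * m + 2) ^ 2 := by exact_mod_cast h2
  have heven : ∀ {a : ℕ} {b : ℤ}, (a : ℤ) = 2 * b → Even a := fun {a b} hab => by
    rw [← Int.even_coe_nat]; exact ⟨b, by linarith⟩
  have h8 : 8 ∣ d := by
    -- Again `R = lam (d - 1) / (k - 1)`; now `R - lam = i² (2i + 1)` with `i` twice an odd number.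
    refine h.eight_dvd (R := (4 * m + 2) * (4 * (4 * m + 2) ^ 2 + 2 * (4 * m + 2) - 1))
      (ρ := (2 * m + 1) ^ 2 * (8 * m + 5))
      (heven (b := (4 * m + 2) * (8 * m + 5)) (by rw [hd']; ring))
      (heven (b := (2 * m + 1) * (8 * m + 5)) (by rw [hk']; ring))
      (heven (b := (2 * m + 1) * (8 * m + 3) * (4 * m + 3)) (by rw [hl']; ring))
      (heven (b := (2 * m + 1) * (4 * m + 2) + (2 * m + 1)) (by rw [h1']; ring))
      (heven (b := (2 * m + 1) * (4 * m + 2)) (by rw [h2']; ring))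
      ?_ ?_ ?_ ?_
    · rw [hk', hd', hl']; ring
    · exact ⟨(2 * m + 1) * (4 * (4 * m + 2) ^ 2 + 2 * (4 * m + 2) - 1), by ring⟩
    · exact (odd_two_mul_add_one _).pow.mul ⟨4 * m + 2, by ring⟩
    · rw [hl']; ring
  have h4 : (d : ℤ) = 8 * (8 * (m : ℤ) ^ 2 + 9 * m + 2) + 4 := by rw [hd']; ring
  omega

end QuasiSymmetric

/-! ### Equality in the relative bound gives a tight frame. -/

section TightFrame

variable {ι : Type*} [Fintype ι]

/-- Equality in the relative bound: the frame operator is a multiple of the identity. -/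
lemma frameOperator_eq_of_relativeBound {d : ℕ} (u : ι → Fin d → ℝ) {κ : ℝ}
    (hd : (d : ℝ) ≠ 0) (h1 : ∀ w, ∑ p, u w p * u w p = 1)
    (hκ : ∀ w w', w ≠ w' → (∑ p, u w p * u w' p) ^ 2 = κ ^ 2)
    (hn : (Fintype.card ι : ℝ) * (1 - κ ^ 2 * d) = d - κ ^ 2 * d) (p q : Fin d) :
    ∑ w, u w p * u w q = if p = q then (Fintype.card ι : ℝ) / d else 0 := by
  classical
  set n : ℝ := (Fintype.card ι : ℝ) with hn'
  set S : Fin d → Fin d → ℝ := fun p q => ∑ w, u w p * u w q with hS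
  have htr : ∑ p, S p p = n := by
    rw [hS, Finset.sum_comm]
    simp [h1, hn']
  have hsq : ∑ p, ∑ q, S p q ^ 2 = n + n * (n - 1) * κ ^ 2 := by
    -- The frame operator and the Gram matrix have the same Frobenius norm.
    have e1 : ∑ p, ∑ q, S p q ^ 2 = ∑ w, ∑ w', (∑ p, u w p * u w' p) ^ 2 := by
      have e2 : ∀ p q, S p q ^ 2 = ∑ w, ∑ w', (u w p * u w' p) * (u w q * u w' q) := by
        intro p q
        rw [hS, sq, Finset.sum_mul_sum]
        exact Finset.sum_congr rfl fun w _ => Finset.sum_congr rfl fun w' _ => by ring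
      simp only [e2, sq, Finset.sum_mul_sum]
      simp only [Finset.sum_comm (s := (Finset.univ : Finset (Fin d))) (t := (Finset.univ : Finset ι))]
    have e3 : ∀ w w', (∑ p, u w p * u w' p) ^ 2 = κ ^ 2 + if w = w' then 1 - κ ^ 2 else 0 := by
      intro w w'
      by_cases h : w = w'
      · subst h; rw [h1, if_pos rfl]; ring
      · rw [hκ w w' h, if_neg h, add_zero]
    rw [e1]
    simp only [e3, Finset.sum_add_distrib, Finset.sum_ite_eq, Finset.mem_univ, if_true,
      Finset.sum_const, Finset.card_univ, nsmul_eq_mul, ← hn']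
    ring
  -- The squared Frobenius distance from `S` to `(n/d) I` is `n + n(n-1)κ² - n²/d`, which is zero
  -- exactly by equality in the relative bound.
  have h0 : ∑ p, ∑ q, (S p q - if p = q then n / d else 0) ^ 2 = 0 := by
    have e4 : ∀ p q, (S p q - if p = q then n / d else 0) ^ 2 =
        S p q ^ 2 + if p = q then -2 * (n / d) * S p q + (n / d) ^ 2 else 0 := by
      intro p q
      split_ifs <;> ring
    simp only [e4, Finset.sum_add_distrib, Finset.sum_ite_eq, Finset.mem_univ, if_true, hsq,
      ← Finset.mul_sum, htr, Finset.sum_const, Finset.card_univ, Fintype.card_fin, nsmul_eq_mul]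
    field_simp
    linear_combination (-n) * hn
  have h2 := (Finset.sum_eq_zero_iff_of_nonneg
    (fun p _ => Finset.sum_nonneg fun q _ => sq_nonneg _)).mp h0 p (Finset.mem_univ p)
  have h3 := (Finset.sum_eq_zero_iff_of_nonneg
    (fun q _ => sq_nonneg _)).mp h2 q (Finset.mem_univ q)
  exact sub_eq_zero.mp (pow_eq_zero_iff two_ne_zero |>.mp h3)

lemma sum_inner_mul_inner_of_relativeBound {d : ℕ} (u : ι → EuclideanSpace ℝ (Fin d)) {κ : ℝ}
    (hd : (d : ℝ) ≠ 0) (h1 : ∀ w, ‖u w‖ = 1)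
    (hκ : ∀ w w', w ≠ w' → |inner ℝ (u w) (u w')| = κ)
    (hn : (Fintype.card ι : ℝ) * (1 - κ ^ 2 * d) = d - κ ^ 2 * d)
    (x y : EuclideanSpace ℝ (Fin d)) :
    ∑ w, inner ℝ (u w) x * inner ℝ (u w) y = (Fintype.card ι : ℝ) / d * inner ℝ x y := by
  have hin : ∀ x y : EuclideanSpace ℝ (Fin d), inner ℝ x y = ∑ p, x p * y p := fun x y => by
    simp [PiLp.inner_apply, mul_comm]
  have hF := frameOperator_eq_of_relativeBound (fun w p => u w p) hd
    (fun w => by rw [← hin, real_inner_self_eq_norm_sq, h1, one_pow])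
    (fun w w' hw => by rw [← hin, ← sq_abs, hκ w w' hw]) hn
  have e : ∀ w, inner ℝ (u w) x * inner ℝ (u w) y =
      ∑ p, ∑ q, (u w p * u w q) * (x p * y q) := fun w => by
    rw [hin, hin, Finset.sum_mul_sum]
    exact Finset.sum_congr rfl fun p _ => Finset.sum_congr rfl fun q _ => by ring
  simp only [e]
  simp only [Finset.sum_comm (s := (Finset.univ : Finset ι)), ← Finset.sum_mul, hF, ite_mul,
    zero_mul, Finset.sum_ite_eq, Finset.mem_univ, if_true]
  rw [hin, Finset.mul_sum]

end TightFrame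

/-! ### Bases with Gram matrix `(1 - κ) I + κ J`. -/

section EquiangularBasis

variable {P E : Type*} [Fintype P] [DecidableEq P] [NormedAddCommGroup E] [InnerProductSpace ℝ E]

lemma sum_mul_inner_of_equiangular {v : P → E} {κ : ℝ} (h1 : ∀ x, ‖v x‖ = 1)
    (hκ : ∀ x y, x ≠ y → inner ℝ (v x) (v y) = κ) (c : P → ℝ) (y : P) :
    inner ℝ (∑ x, c x • v x) (v y) = (1 - κ) * c y + κ * ∑ x, c x := by
  have h : ∀ x, inner ℝ (c x • v x) (v y) = (if x = y then (1 - κ) * c x else 0) + κ * c x := by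
    intro x
    rw [real_inner_smul_left]
    by_cases hxy : x = y
    · subst hxy
      rw [real_inner_self_eq_norm_sq, h1, if_pos rfl]; ring
    · rw [hκ x y hxy, if_neg hxy]; ring
  rw [sum_inner]
  simp only [h, Finset.sum_add_distrib, Finset.sum_ite_eq', Finset.mem_univ, if_true,
    ← Finset.mul_sum]

lemma linearIndependent_of_equiangular {v : P → E} {κ : ℝ} (h0 : 0 ≤ κ) (hκ1 : κ < 1)
    (h1 : ∀ x, ‖v x‖ = 1) (hκ : ∀ x y, x ≠ y → inner ℝ (v x) (v y) = κ) :
    LinearIndependent ℝ v := by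
  rw [Fintype.linearIndependent_iff]
  intro c hc
  have h : ∀ y, (1 - κ) * c y + κ * ∑ x, c x = 0 := fun y => by
    rw [← sum_mul_inner_of_equiangular h1 hκ, hc, inner_zero_left]
  have hs : ∑ x, c x = 0 := by
    have := Finset.sum_congr rfl fun y (_ : y ∈ (Finset.univ : Finset P)) => h y
    rw [Finset.sum_add_distrib, ← Finset.mul_sum, Finset.sum_const, nsmul_eq_mul,
      Finset.sum_const_zero] at this
    have h' : ((1 - κ) + (Finset.univ : Finset P).card * κ) * ∑ x, c x = 0 := by
      linear_combination this
    refine (mul_eq_zero.mp h').resolve_left (ne_of_gt ?_)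
    have : 0 ≤ ((Finset.univ : Finset P).card : ℝ) * κ := by positivity
    linarith
  intro y
  have := h y
  rw [hs, mul_zero, add_zero] at this
  exact (mul_eq_zero.mp this).resolve_left (by linarith)

/-- The inner product of two vectors in terms of their inner products with a basis of unit vectors
at pairwise inner product `κ`. -/
lemma inner_eq_of_equiangular_basis [FiniteDimensional ℝ E] {v : P → E} {κ : ℝ} (h0 : 0 ≤ κ)
    (hκ1 : κ < 1) (h1 : ∀ x, ‖v x‖ = 1) (hκ : ∀ x y, x ≠ y → inner ℝ (v x) (v y) = κ)
    (hcard : Fintype.card P = Module.finrank ℝ E) (w w' : E) :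
    (1 - κ) * (1 - κ + κ * Fintype.card P) * inner ℝ w w' =
      (1 - κ + κ * Fintype.card P) * ∑ x, inner ℝ w (v x) * inner ℝ w' (v x) -
        κ * (∑ x, inner ℝ w (v x)) * ∑ x, inner ℝ w' (v x) := by
  have hspan := (linearIndependent_of_equiangular h0 hκ1 h1 hκ).span_eq_top_of_card_eq_finrank'
    hcard
  set F := ∑ x, inner ℝ w (v x) with hF
  set D := 1 - κ + κ * Fintype.card P with hD
  -- The coefficients come from inverting `(1 - κ) I + κ J`, with denominators cleared. The two
  -- sides have equal inner products with every `v y`, and the `v y` span.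
  have hz : ((1 - κ) * D) • w = ∑ x, (D * inner ℝ w (v x) - κ * F) • v x := by
    rw [← sub_eq_zero]
    refine inner_self_eq_zero (𝕜 := ℝ) |>.mp ?_
    generalize hz : ((1 - κ) * D) • w - ∑ x, (D * inner ℝ w (v x) - κ * F) • v x = z
    have hy : ∀ y, inner ℝ z (v y) = 0 := by
      intro y
      rw [← hz, inner_sub_left, sum_mul_inner_of_equiangular h1 hκ, real_inner_smul_left,
        Finset.sum_sub_distrib, ← Finset.mul_sum, ← hF, Finset.sum_const, nsmul_eq_mul,
        Finset.card_univ, hD]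
      ring
    have hmem : ∀ t ∈ Submodule.span ℝ (Set.range v), inner ℝ z t = 0 := by
      intro t ht
      induction ht using Submodule.span_induction with
      | mem t ht => obtain ⟨y, rfl⟩ := ht; exact hy y
      | zero => simp
      | add s t _ _ hs ht => rw [inner_add_right, hs, ht, add_zero]
      | smul a t _ ht => rw [inner_smul_right, ht, mul_zero]
    exact hmem z (hspan ▸ Submodule.mem_top)
  have h2 := congrArg (fun t => inner ℝ t w') hz
  simp only [real_inner_smul_left, sum_inner] at h2
  rw [h2, Finset.mul_sum Finset.univ _ D, Finset.mul_sum Finset.univ _ (κ * F),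
    ← Finset.sum_sub_distrib]
  refine Finset.sum_congr rfl fun x _ => ?_
  rw [real_inner_comm w' (v x)]
  ring

end EquiangularBasis

/-! ### Sign vectors relative to an equiangular basis. -/

section EquiangularDesign

variable {P E : Type*} [Fintype P] [DecidableEq P] [NormedAddCommGroup E] [InnerProductSpace ℝ E]

/-- Scaling by `a = 1/κ` turns the inner products of the lines with the basis into signs, so that
integer arithmetic applies. -/
lemma inner_eq_of_equiangular_basis_scaled [FiniteDimensional ℝ E] {v : P → E} {a : ℝ}
    (ha : 1 < a) (h1 : ∀ x, ‖v x‖ = 1) (hκ : ∀ x y, x ≠ y → inner ℝ (v x) (v y) = 1 / a)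
    (hcard : Fintype.card P = Module.finrank ℝ E) (w w' : E) :
    (a - 1) * (a - 1 + Fintype.card P) * (a * inner ℝ w w') =
      (a - 1 + Fintype.card P) * ∑ x, (a * inner ℝ w (v x)) * (a * inner ℝ w' (v x)) -
        (∑ x, a * inner ℝ w (v x)) * ∑ x, a * inner ℝ w' (v x) := by
  have ha0 : a ≠ 0 := by linarith
  have h := inner_eq_of_equiangular_basis (by positivity) (by rw [div_lt_one] <;> linarith) h1 hκ
    hcard w w'
  have e : ∑ x, (a * inner ℝ w (v x)) * (a * inner ℝ w' (v x)) =
      a ^ 2 * ∑ x, inner ℝ w (v x) * inner ℝ w' (v x) := by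
    rw [Finset.mul_sum]
    exact Finset.sum_congr rfl fun x _ => by ring
  rw [e, ← Finset.mul_sum, ← Finset.mul_sum]
  generalize ∑ x, inner ℝ w (v x) * inner ℝ w' (v x) = A at h ⊢
  generalize ∑ x, inner ℝ w (v x) = B at h ⊢
  generalize ∑ x, inner ℝ w' (v x) = C at h ⊢
  generalize inner ℝ w w' = D at h ⊢
  field_simp at h
  linear_combination a * h

/-- The sign vector of a unit vector at angle `1 / a` to a basis of unit vectors at angle `1 / a`,
normalized so that the sum of its entries is negative. -/
lemma exists_sign_vector [FiniteDimensional ℝ E] {v : P → E} {i : ℕ} (hi : 0 < i)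
    (h1 : ∀ x, ‖v x‖ = 1)
    (hκ : ∀ x y, x ≠ y → inner ℝ (v x) (v y) = 1 / ((i : ℝ) ^ 2 + 3 * i + 1))
    (hcard : Fintype.card P = Module.finrank ℝ E)
    (hd : (Fintype.card P : ℝ) = ((i : ℝ) ^ 2 + 3 * i + 1) ^ 2 - i - 1) {w : E} (hw : ‖w‖ = 1)
    (hwv : ∀ x, |inner ℝ w (v x)| = 1 / ((i : ℝ) ^ 2 + 3 * i + 1)) :
    ∃ (η : P → ℤ) (τ : ℤ), τ * τ = 1 ∧ (∀ x, η x = 1 ∨ η x = -1) ∧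
      (∀ x, ((i : ℝ) ^ 2 + 3 * i + 1) * inner ℝ w (v x) = τ * η x) ∧
      ∑ x, η x = -((i : ℤ) * (i + 2) ^ 2) := by
  have hi' : (0 : ℝ) < i := by exact_mod_cast hi
  set a : ℝ := (i : ℝ) ^ 2 + 3 * i + 1 with ha
  have ha1 : 1 < a := by rw [ha]; nlinarith
  have hs : ∀ x, ∃ e : ℤ, (e = 1 ∨ e = -1) ∧ a * inner ℝ w (v x) = e := by
    intro x
    rcases (abs_eq (by positivity)).mp (hwv x) with h | h
    · exact ⟨1, Or.inl rfl, by rw [h]; push_cast; field_simp⟩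
    · exact ⟨-1, Or.inr rfl, by rw [h]; push_cast; field_simp⟩
  choose η hη hηw using hs
  have h := inner_eq_of_equiangular_basis_scaled ha1 h1 hκ hcard w w
  have hsq : ∀ x, η x * η x = 1 := fun x => by rcases hη x with h | h <;> rw [h] <;> norm_num
  have hsq' : ∀ x, (η x : ℝ) * η x = 1 := fun x => by exact_mod_cast hsq x
  rw [real_inner_self_eq_norm_sq, hw] at h
  simp only [hηw, hsq', Finset.sum_const, Finset.card_univ, nsmul_eq_mul, mul_one] at h
  rw [hd] at h
  -- The condition `‖w‖ = 1` gives `(∑ η)² = (d + a - 1)(d - a(a - 1))`, and the two factors are `i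
  -- (i + 2)³` and `i (i + 2)`.
  have hE : (∑ x, (η x : ℝ)) ^ 2 = ((i : ℝ) * (i + 2) ^ 2) ^ 2 := by
    rw [ha] at h
    linear_combination h
  have hE' : (∑ x, η x) ^ 2 = ((i : ℤ) * (i + 2) ^ 2) ^ 2 := by exact_mod_cast hE
  rcases sq_eq_sq_iff_eq_or_eq_neg.mp hE' with h | h
  · refine ⟨fun x => -η x, -1, by norm_num, fun x => ?_, fun x => ?_, ?_⟩
    · rcases hη x with h | h <;> simp [h]
    · rw [hηw]; push_cast; ring
    · rw [Finset.sum_neg_distrib, h]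
  · exact ⟨η, 1, by norm_num, hη, fun x => by rw [hηw]; push_cast; ring, h⟩

/-- Once both sign sums are normalized, the inner product formula is linear in `∑ η η'`; the two
outcomes correspond to the sign of `inner ℝ w w'` corrected by `τ τ'`. -/
lemma sum_sign_mul_sign [FiniteDimensional ℝ E] {v : P → E} {i : ℕ} (hi : 0 < i)
    (h1 : ∀ x, ‖v x‖ = 1)
    (hκ : ∀ x y, x ≠ y → inner ℝ (v x) (v y) = 1 / ((i : ℝ) ^ 2 + 3 * i + 1))
    (hcard : Fintype.card P = Module.finrank ℝ E)
    (hd : (Fintype.card P : ℝ) = ((i : ℝ) ^ 2 + 3 * i + 1) ^ 2 - i - 1) {w w' : E}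
    (hww : |inner ℝ w w'| = 1 / ((i : ℝ) ^ 2 + 3 * i + 1)) {η η' : P → ℤ} {τ τ' : ℤ}
    (hτ : τ * τ = 1) (hτ' : τ' * τ' = 1)
    (hη : ∀ x, ((i : ℝ) ^ 2 + 3 * i + 1) * inner ℝ w (v x) = τ * η x)
    (hη' : ∀ x, ((i : ℝ) ^ 2 + 3 * i + 1) * inner ℝ w' (v x) = τ' * η' x)
    (hs : ∑ x, η x = -((i : ℤ) * (i + 2) ^ 2)) (hs' : ∑ x, η' x = -((i : ℤ) * (i + 2) ^ 2)) :
    ∑ x, η x * η' x = (i : ℤ) * (i + 2) + i * (i + 3) ∨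
      ∑ x, η x * η' x = (i : ℤ) * (i + 2) - i * (i + 3) := by
  have hi' : (0 : ℝ) < i := by exact_mod_cast hi
  set a : ℝ := (i : ℝ) ^ 2 + 3 * i + 1 with ha
  have ha1 : 1 < a := by rw [ha]; nlinarith
  have h := inner_eq_of_equiangular_basis_scaled ha1 h1 hκ hcard w w'
  obtain ⟨σ, hσ, hσw⟩ : ∃ σ : ℤ, σ * σ = 1 ∧ a * inner ℝ w w' = σ := by
    rcases (abs_eq (by positivity)).mp hww with h | h
    · exact ⟨1, by norm_num, by rw [h]; push_cast; field_simp⟩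
    · exact ⟨-1, by norm_num, by rw [h]; push_cast; field_simp⟩
  have e1 : ∑ x, ((τ : ℝ) * η x) * (τ' * η' x) = τ * τ' * ∑ x, (η x : ℝ) * η' x := by
    rw [Finset.mul_sum]
    exact Finset.sum_congr rfl fun x _ => by ring
  have hsR : ∑ x, (η x : ℝ) = -((i : ℝ) * (i + 2) ^ 2) := by exact_mod_cast hs
  have hsR' : ∑ x, (η' x : ℝ) = -((i : ℝ) * (i + 2) ^ 2) := by exact_mod_cast hs'
  simp only [hη, hη', hσw] at h
  rw [e1, ← Finset.mul_sum, ← Finset.mul_sum, hsR, hsR', hd, ha] at h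
  have hτR : (τ : ℝ) * τ = 1 := by exact_mod_cast hτ
  have hτR' : (τ' : ℝ) * τ' = 1 := by exact_mod_cast hτ'
  -- The common factor `i (i + 2)³` is `d + a - 1`.
  have h2 : ((i : ℝ) * (i + 2) ^ 3) * (∑ x, (η x : ℝ) * η' x) =
      ((i : ℝ) * (i + 2) ^ 3) * ((i : ℝ) * (i + 2) + τ * τ' * σ * (i * (i + 3))) := by
    generalize ∑ x, (η x : ℝ) * η' x = A at h ⊢
    have h3 := congrArg (fun t : ℝ => τ * τ' * t) h
    linear_combination (-1 : ℝ) * h3 +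
      ((i : ℝ) ^ 2 * (i + 2) ^ 4 - (i : ℝ) * (i + 2) ^ 3 * A) * (τ' * τ' * hτR + hτR')
  have h4 := mul_left_cancel₀ (by positivity) h2
  have h5 : ∑ x, η x * η' x = (i : ℤ) * (i + 2) + (τ * τ' * σ) * (i * (i + 3)) := by
    exact_mod_cast h4
  have h6 : (τ * τ' * σ) * (τ * τ' * σ) = 1 := by
    linear_combination (τ' * τ' * σ * σ) * hτ + (σ * σ) * hτ' + hσ
  rcases mul_self_eq_one_iff.mp h6 with h7 | h7 <;> rw [h7] at h5
  · left; linear_combination h5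
  · right; linear_combination h5

end EquiangularDesign

/-! ### From sign vectors to an even design. -/

section EquiangularDesign

variable {P W : Type*} [Fintype P] [DecidableEq P] [Fintype W]

/-- Sign vectors with constant sum and with the orthogonality relations coming from a tight frame
define a design. -/
lemma card_filter_of_sign_vectors {η : W → P → ℤ} (hη : ∀ w x, η w x = 1 ∨ η w x = -1) {e c T : ℤ}
    (he : e ≠ 0) (hs : ∀ w, ∑ x, η w x = e) (hc : ∀ x y, x ≠ y → ∑ w, η w x * η w y = c)
    (hT : e * T = Fintype.card W + (Fintype.card P - 1) * c) :
    (∀ x, 2 * ((Finset.univ.filter fun w => η w x = 1).card : ℤ) = Fintype.card W + T) ∧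
    ∀ x y, x ≠ y → 4 * ((Finset.univ.filter fun w => η w x = 1 ∧ η w y = 1).card : ℤ) =
      c + 2 * T + Fintype.card W := by
  have hsq : ∀ w x, η w x * η w x = 1 := fun w x => by
    rcases hη w x with h | h <;> rw [h] <;> norm_num
  -- Summing `η w x * η w y` over `x` and `w` gives `e` times the column sum at `y`, so constant row
  -- sums and constant column products force constant column sums.
  have hcol : ∀ y, ∑ w, η w y = T := by
    intro y
    apply mul_left_cancel₀ he
    have h : ∑ x, ∑ w, η w x * η w y = ∑ x, (c + if x = y then Fintype.card W - c else 0) := by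
      refine Finset.sum_congr rfl fun x _ => ?_
      by_cases hxy : x = y
      · subst hxy
        simp [hsq]
      · rw [hc x y hxy, if_neg hxy, add_zero]
    rw [Finset.sum_comm] at h
    simp only [← Finset.sum_mul, hs, Finset.sum_add_distrib, Finset.sum_ite_eq', Finset.mem_univ,
      if_true, Finset.sum_const, Finset.card_univ, nsmul_eq_mul, ← Finset.mul_sum] at h
    rw [h, hT]
    ring
  constructor
  · intro x
    have h : ∀ w, η w x = 2 * (if η w x = 1 then 1 else 0) - 1 := fun w => by
      rcases hη w x with h | h <;> rw [h] <;> norm_num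
    have h2 := hcol x
    rw [Finset.sum_congr rfl fun w _ => h w, Finset.sum_sub_distrib, ← Finset.mul_sum,
      Finset.sum_boole] at h2
    simp only [Finset.sum_const, Finset.card_univ, nsmul_eq_mul, mul_one] at h2
    linarith
  · intro x y hxy
    have h : ∀ w, η w x * η w y + η w x + η w y + 1 =
        4 * (if η w x = 1 ∧ η w y = 1 then 1 else 0) := fun w => by
      rcases hη w x with h | h <;> rcases hη w y with h' | h' <;> rw [h, h'] <;> norm_num
    have h2 := Finset.sum_congr rfl fun w (_ : w ∈ (Finset.univ : Finset W)) => h w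
    simp only [Finset.sum_add_distrib, hc x y hxy, hcol, ← Finset.mul_sum, Finset.sum_boole] at h2
    simp only [Finset.sum_const, Finset.card_univ, nsmul_eq_mul, mul_one] at h2
    linarith

/-- The product `(1 + η x)(1 + η' x)` is `4` on the intersection and `0` elsewhere. -/
lemma four_mul_card_inter_of_sign_vectors {η η' : P → ℤ} (hη : ∀ x, η x = 1 ∨ η x = -1)
    (hη' : ∀ x, η' x = 1 ∨ η' x = -1) :
    4 * (((Finset.univ.filter fun x => η x = 1) ∩
      (Finset.univ.filter fun x => η' x = 1)).card : ℤ) =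
      ∑ x, η x * η' x + ∑ x, η x + ∑ x, η' x + Fintype.card P := by
  have h : ∀ x, η x * η' x + η x + η' x + 1 =
      4 * (if η x = 1 ∧ η' x = 1 then 1 else 0) := fun x => by
    rcases hη x with h | h <;> rcases hη' x with h' | h' <;> rw [h, h'] <;> norm_num
  have h2 := Finset.sum_congr rfl fun x (_ : x ∈ (Finset.univ : Finset P)) => h x
  simp only [Finset.sum_add_distrib, ← Finset.mul_sum, Finset.sum_boole] at h2
  simp only [Finset.sum_const, Finset.card_univ, nsmul_eq_mul, mul_one] at h2
  rw [← Finset.filter_and, ← h2]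

/-- There is no equiangular tight frame in `ℝ^d`, `d = i (i³ + 6 i² + 11 i + 5)`, `i ≡ 4` modulo
`8`, with angle `1 / (i² + 3 i + 1)` containing a basis with all inner products positive. -/
theorem no_equiangular_tight_frame_with_positive_basis {m d : ℕ}
    (hd : d = (8 * m + 4) * ((8 * m + 4) ^ 3 + 6 * (8 * m + 4) ^ 2 + 11 * (8 * m + 4) + 5))
    {a : ℝ} (ha : a = (((8 * m + 4 : ℕ) : ℝ)) ^ 2 + 3 * ((8 * m + 4 : ℕ) : ℝ) + 1)
    (hP : Fintype.card P = d)
    (hW : ((Fintype.card P + Fintype.card W : ℕ) : ℝ) = (d - (1 / a) ^ 2 * d) / (1 - (1 / a) ^ 2 * d))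
    (v : P → EuclideanSpace ℝ (Fin d)) (w : W → EuclideanSpace ℝ (Fin d))
    (hv : ∀ x, ‖v x‖ = 1) (hw : ∀ s, ‖w s‖ = 1)
    (hvv : ∀ x y, x ≠ y → inner ℝ (v x) (v y) = 1 / a)
    (hwv : ∀ s x, |inner ℝ (w s) (v x)| = 1 / a)
    (hww : ∀ s t, s ≠ t → |inner ℝ (w s) (w t)| = 1 / a) : False := by
  set i : ℕ := 8 * m + 4 with hi
  have hi0 : 0 < i := by omega
  have hiR : (0 : ℝ) < i := by exact_mod_cast hi0
  have ha0 : 0 < a := by rw [ha]; positivity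
  have hdR : (d : ℝ) = a ^ 2 - i - 1 := by rw [hd, ha]; push_cast; ring
  have hd0 : (d : ℝ) ≠ 0 := by
    rw [hd]; push_cast; positivity
  have hden : 1 - (1 / a) ^ 2 * (d : ℝ) = (i + 1) / a ^ 2 := by
    rw [hdR]; field_simp; ring
  have hden0 : 1 - (1 / a) ^ 2 * (d : ℝ) ≠ 0 := by rw [hden]; positivity
  -- The frame constant `|Ω| / d` equals `i (i + 2) (i + 3)`.
  have hN : ((Fintype.card P + Fintype.card W : ℕ) : ℝ) = d * (i * (i + 2) * (i + 3)) := by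
    rw [hW, div_eq_iff hden0, hden]
    field_simp
    rw [ha]; ring
  have hcard : Fintype.card P = Module.finrank ℝ (EuclideanSpace ℝ (Fin d)) := by
    rw [finrank_euclideanSpace_fin, hP]
  have hPR : (Fintype.card P : ℝ) = ((i : ℝ) ^ 2 + 3 * i + 1) ^ 2 - i - 1 := by
    rw [hP, hdR, ha]
  have hframe : ∀ x y : P, ∑ z, inner ℝ (v z) (v x) * inner ℝ (v z) (v y) +
      ∑ s, inner ℝ (w s) (v x) * inner ℝ (w s) (v y) =
        (i * (i + 2) * (i + 3)) * inner ℝ (v x) (v y) := by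
    intro x y
    have h := sum_inner_mul_inner_of_relativeBound (Sum.elim v w) (κ := 1 / a) hd0
      (by rintro (x | s) <;> simp [hv, hw]) ?_ ?_ (v x) (v y)
    · rw [Fintype.sum_sum_type, Fintype.card_sum, hN, mul_div_cancel_left₀ _ hd0] at h
      exact h
    · have hκ : |1 / a| = 1 / a := abs_of_pos (by positivity)
      rintro (x | s) (y | t) hne
      · rw [Sum.elim_inl, Sum.elim_inl, hvv x y (fun h => hne (by rw [h])), hκ]
      · rw [Sum.elim_inl, Sum.elim_inr, real_inner_comm, hwv]
      · rw [Sum.elim_inl, Sum.elim_inr, hwv]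
      · exact hww s t (fun h => hne (by rw [h]))
    · rw [Fintype.card_sum, hW, div_mul_cancel₀ _ hden0]
  rw [ha] at hvv hwv hww
  choose η τ hτ hη hηw hηs using fun s => exists_sign_vector hi0 hv hvv hcard hPR (hw s) (hwv s)
  rw [← ha] at hvv
  simp only [← ha] at hηw
  have hbasis : ∀ x y, x ≠ y → ∑ z, inner ℝ (v z) (v x) * inner ℝ (v z) (v y) =
      2 * (1 / a) + (d - 2) * (1 / a) ^ 2 := by
    intro x y hxy
    have h : ∀ z, inner ℝ (v z) (v x) * inner ℝ (v z) (v y) = (1 / a) ^ 2 +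
        (if z = x then (1 / a) - (1 / a) ^ 2 else 0) +
        (if z = y then (1 / a) - (1 / a) ^ 2 else 0) := by
      intro z
      by_cases hx : z = x
      · subst hx
        rw [hvv z y hxy, real_inner_self_eq_norm_sq, hv, if_pos rfl, if_neg hxy]; ring
      · by_cases hy : z = y
        · subst hy
          rw [hvv z x hx, real_inner_self_eq_norm_sq, hv, if_pos rfl, if_neg hx]; ring
        · rw [hvv z x hx, hvv z y hy, if_neg hx, if_neg hy]; ring
    simp only [h, Finset.sum_add_distrib, Finset.sum_ite_eq', Finset.mem_univ, if_true,
      Finset.sum_const, Finset.card_univ, hP, nsmul_eq_mul]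
    ring
  -- Subtracting the contribution of the basis from the tight frame identity leaves that of the sign
  -- vectors.
  have hcR : ∀ x y, x ≠ y → ∑ s, (η s x : ℝ) * η s y =
      a * (i * (i + 2) * (i + 3)) - 2 * a - (d - 2) := by
    intro x y hxy
    have h := hframe x y
    rw [hbasis x y hxy, hvv x y hxy] at h
    have e : ∑ s, (η s x : ℝ) * η s y =
        a ^ 2 * ∑ s, inner ℝ (w s) (v x) * inner ℝ (w s) (v y) := by
      rw [Finset.mul_sum]
      refine Finset.sum_congr rfl fun s _ => ?_
      have hτs : (τ s : ℝ) * τ s = 1 := by exact_mod_cast hτ s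
      linear_combination (-(η s x : ℝ) * η s y) * hτs - a * inner ℝ (w s) (v y) * hηw s x -
        τ s * η s x * hηw s y
    rw [e, eq_sub_of_add_eq' h]
    field_simp
    ring
  have hdZ : (d : ℤ) = i * (i ^ 3 + 6 * i ^ 2 + 11 * i + 5) := by rw [hd]; push_cast; ring
  have hc : ∀ x y, x ≠ y → ∑ s, η s x * η s y =
      (i ^ 2 + 3 * i + 1) * (i * (i + 2) * (i + 3)) - 2 * (i ^ 2 + 3 * i + 1) - (d - 2) := by
    intro x y hxy
    have h := hcR x y hxy
    rw [ha] at h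
    exact_mod_cast h
  have hWZ : (Fintype.card W : ℤ) = d * (i * (i + 2) * (i + 3) - 1) := by
    have h : ((Fintype.card P : ℤ) + Fintype.card W) = d * (i * (i + 2) * (i + 3)) := by
      exact_mod_cast hN
    rw [hP] at h
    linear_combination h
  have hiZ : (i : ℤ) = 8 * m + 4 := by rw [hi]; push_cast; ring
  set K : ℤ := (i : ℤ) ^ 3 + 5 * i ^ 2 + 7 * i + 1 with hK
  -- `R` and `L` are the replication number and `lam` of Family 1. The blocks stay indexed by `W`,
  -- so their distinctness is never needed.
  set R : ℤ := (4 * m + 2) * K * ((i : ℤ) ^ 3 + 5 * i ^ 2 + 6 * i - 1) with hR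
  set L : ℤ := (2 * m + 1) * (i + 2) * ((i : ℤ) ^ 2 + 2 * i - 1) * K with hL
  obtain ⟨hr, hl⟩ := card_filter_of_sign_vectors hη (e := -((i : ℤ) * (i + 2) ^ 2))
    (T := 2 * R - Fintype.card W) (by
      have : (0 : ℤ) < (i : ℤ) * (i + 2) ^ 2 := by positivity
      omega) hηs hc (by
      rw [hP, hWZ, hdZ, hR, hK, hiZ]; ring)
  have hr' : ∀ x, ((Finset.univ.filter fun s => η s x = 1).card : ℤ) = R := fun x => by
    linarith [hr x]
  have hl' : ∀ x y, x ≠ y →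
      ((Finset.univ.filter fun s => η s x = 1 ∧ η s y = 1).card : ℤ) = L := fun x y hxy => by
    have h := hl x y hxy
    have h2 : 4 * ((Finset.univ.filter fun s => η s x = 1 ∧ η s y = 1).card : ℤ) = 4 * L := by
      rw [h, hWZ, hdZ, hR, hL, hK, hiZ]; ring
    linarith
  have hR0 : 0 ≤ R := by
    rw [hR, hK, hiZ]
    have : (0 : ℤ) ≤ (8 * m + 4) ^ 3 + 5 * (8 * m + 4) ^ 2 + 6 * (8 * m + 4) - 1 := by
      have : (0 : ℤ) ≤ (8 * m + 4) ^ 3 + 5 * (8 * m + 4) ^ 2 := by positivity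
      omega
    positivity
  have hL0 : 0 ≤ L := by
    rw [hL, hK, hiZ]
    have : (0 : ℤ) ≤ (8 * m + 4) ^ 2 + 2 * (8 * m + 4) - 1 := by
      have : (0 : ℤ) ≤ (8 * m + 4 : ℤ) ^ 2 := by positivity
      omega
    positivity
  clear_value R L
  lift R to ℕ using hR0
  lift L to ℕ using hL0
  have hK2 : Odd K := by
    rw [hK, hiZ]
    exact ⟨(4 * m + 2) * ((8 * m + 4) ^ 2 + 5 * (8 * m + 4) + 7), by ring⟩
  have heven : ∀ {a : ℕ} {b : ℤ}, (a : ℤ) = 2 * b → Even a := fun {a b} hab => by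
    rw [← Int.even_coe_nat]; exact ⟨b, by linarith⟩
  have hd4 : (d : ℤ) % 8 = 4 := by
    have h : (d : ℤ) = 8 * (m * ((i : ℤ) ^ 3 + 6 * i ^ 2 + 11 * i + 5) +
        ((4 * m + 2) * ((8 * m + 4) ^ 2 + 6 * (8 * m + 4) + 11) + 2)) + 4 := by
      rw [hdZ, hiZ]; ring
    omega
  have h8 : 8 ∣ Fintype.card P := by
    refine eight_dvd_card_of_even_design (fun s => Finset.univ.filter fun x => η s x = 1)
      (r := R) (lam := L) (ρ := (2 * m + 1) ^ 2 * K * (i + 3) ^ 2) ?_ ?_ ?_ ?_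
      (heven (b := (2 * m + 1) * K * ((i : ℤ) ^ 3 + 5 * i ^ 2 + 6 * i - 1)) (by rw [hR]; ring))
      (heven (b := (2 * m + 1) * (4 * m + 3) * ((i : ℤ) ^ 2 + 2 * i - 1) * K)
        (by rw [hL, hiZ]; ring)) ?_ ?_
    · intro x
      simpa using by exact_mod_cast hr' x
    · intro x y hxy
      simpa using by exact_mod_cast hl' x y hxy
    · intro s t
      have h := four_mul_card_inter_of_sign_vectors (hη s) (hη t)
      rw [hηs, hηs, hP] at h
      have he : (i : ℤ) * (i + 2) ^ 2 = 8 * ((2 * m + 1) * (i + 2) * (4 * m + 3)) := by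
        rw [hiZ]; ring
      have hA : ∑ x, η s x * η t x = d ∨ ∑ x, η s x * η t x = (i : ℤ) * (i + 2) + i * (i + 3) ∨
          ∑ x, η s x * η t x = (i : ℤ) * (i + 2) - i * (i + 3) := by
        by_cases hst : s = t
        · subst hst
          left
          have hsq : ∀ x, η s x * η s x = 1 := fun x => by
            rcases hη s x with h | h <;> rw [h] <;> norm_num
          simp [hsq, hP]
        · right
          exact sum_sign_mul_sign hi0 hv (by rw [← ha]; exact hvv) hcard hPR (hww s t hst)
            (hτ s) (hτ t) (by rw [← ha]; exact hηw s) (by rw [← ha]; exact hηw t) (hηs s) (hηs t)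
      -- All three possible values are `4` modulo `8`; adding `d ≡ 4` and two row sums divisible by
      -- `8` shows `8 ∣ 4 |B s ∩ B t|`, block sizes included.
      have hA8 : (∑ x, η s x * η t x) % 8 = 4 := by
        have e2 : (i : ℤ) * (i + 2) = 8 * ((2 * m + 1) * (4 * m + 3)) := by rw [hiZ]; ring
        have e3 : (i : ℤ) * (i + 3) = 8 * (m * (i + 3) + (4 * m + 3)) + 4 := by rw [hiZ]; ring
        rcases hA with h | h | h <;> omega
      rw [← Int.even_coe_nat, Int.even_iff]
      omega
    · rw [hP, ← Int.even_coe_nat, Int.even_iff]; omega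
    · exact ((odd_two_mul_add_one _).pow.mul hK2).mul (Odd.pow ⟨4 * m + 3, by rw [hiZ]; ring⟩)
    · rw [hR, hL, hiZ]; ring
  rw [hP] at h8
  omega

end EquiangularDesign

/-! ### From saturated incoherence to an equiangular basis. -/

section Incoherence

variable {d : ℕ}

lemma exists_isIncoherent_card_eq_incoherence
    (Ω : Finset (Submodule ℝ (EuclideanSpace ℝ (Fin d)))) :
    ∃ Γ ⊆ Ω, IsIncoherent Γ ∧ Γ.card = incoherence Ω := by
  classical
  have hne : (Ω.powerset.filter IsIncoherent).Nonempty :=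
    ⟨∅, Finset.mem_filter.mpr ⟨Finset.empty_mem_powerset Ω, Or.inl (by simp)⟩⟩
  obtain ⟨Γ, hΓ, h⟩ := Finset.exists_mem_eq_sup _ hne Finset.card
  rw [Finset.mem_filter, Finset.mem_powerset] at hΓ
  refine ⟨Γ, hΓ.1, hΓ.2, ?_⟩
  rw [incoherence, ← h]

lemma exists_unit_mem_of_finrank_eq_one {L : Submodule ℝ (EuclideanSpace ℝ (Fin d))}
    (hL : Module.finrank ℝ L = 1) : ∃ u ∈ L, ‖u‖ = 1 := by
  have : Nontrivial L := Module.nontrivial_of_finrank_pos (R := ℝ) (by omega)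
  obtain ⟨u, hu⟩ := exists_norm_eq L (zero_le_one (α := ℝ))
  exact ⟨u, u.2, hu⟩

/-- The lines of an incoherent set are spanned by unit vectors with positive inner products. -/
lemma IsIncoherent.exists_unit_vectors {Ω Γ : Finset (Submodule ℝ (EuclideanSpace ℝ (Fin d)))}
    {κ : ℝ} (hΩ : IsEquiangular Ω κ) (hΓΩ : Γ ⊆ Ω) (hΓ : IsIncoherent Γ) (h3 : 2 < Γ.card) :
    ∃ v : Submodule ℝ (EuclideanSpace ℝ (Fin d)) → EuclideanSpace ℝ (Fin d),
      (∀ L ∈ Γ, v L ∈ L ∧ ‖v L‖ = 1) ∧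
      ∀ L ∈ Γ, ∀ M ∈ Γ, L ≠ M → inner ℝ (v L) (v M) = κ := by
  have hpos := hΓ.resolve_left (by omega)
  obtain ⟨L₀, h₀⟩ := Finset.card_pos.mp (by omega : 0 < Γ.card)
  obtain ⟨u₀, hu₀, hn₀⟩ := exists_unit_mem_of_finrank_eq_one (hΩ.isLine L₀ (hΓΩ h₀))
  -- Each spanning vector is signed to have nonnegative inner product with `u₀`; positivity of the
  -- triple products then makes all other inner products positive.
  have hex : ∀ L, ∃ u, L ∈ Γ → u ∈ L ∧ ‖u‖ = 1 ∧ 0 ≤ inner ℝ u₀ u ∧ (L = L₀ → u = u₀) := by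
    intro L
    by_cases hL : L ∈ Γ
    · by_cases hLL : L = L₀
      · subst hLL
        exact ⟨u₀, fun _ => ⟨hu₀, hn₀, real_inner_self_nonneg, fun _ => rfl⟩⟩
      · obtain ⟨u, hu, hn⟩ := exists_unit_mem_of_finrank_eq_one (hΩ.isLine L (hΓΩ hL))
        rcases le_total 0 (inner ℝ u₀ u) with h | h
        · exact ⟨u, fun _ => ⟨hu, hn, h, fun h => absurd h hLL⟩⟩
        · refine ⟨-u, fun _ => ⟨L.neg_mem hu, by rw [norm_neg, hn], ?_, fun h => absurd h hLL⟩⟩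
          rw [inner_neg_right]
          linarith
    · exact ⟨0, fun h => absurd h hL⟩
  choose v hv using hex
  refine ⟨v, fun L hL => ⟨(hv L hL).1, (hv L hL).2.1⟩, fun L hL M hM hLM => ?_⟩
  have hang := hΩ.angle L (hΓΩ hL) M (hΓΩ hM) hLM _ (hv L hL).1 _ (hv M hM).1
    (hv L hL).2.1 (hv M hM).2.1
  rw [← hang, eq_comm, abs_eq_self]
  by_cases h1 : L = L₀
  · rw [(hv L hL).2.2.2 h1]
    exact (hv M hM).2.2.1
  by_cases h2 : M = L₀
  · rw [(hv M hM).2.2.2 h2, real_inner_comm]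
    exact (hv L hL).2.2.1
  have h := hpos L₀ h₀ L hL M hM (Ne.symm h1) (Ne.symm h2) hLM u₀ hu₀ _ (hv L hL).1 _ (hv M hM).1
    hn₀ (hv L hL).2.1 (hv M hM).2.1
  exact (pos_of_mul_pos_right h (mul_nonneg (hv L hL).2.2.1 (hv M hM).2.2.1)).le

theorem incoherence_lt_of_saturatesRelativeBound {i : ℕ} (hi : i ≡ 4 [MOD 8])
    (hd : d = i * (i ^ 3 + 6 * i ^ 2 + 11 * i + 5))
    (Ω : Finset (Submodule ℝ (EuclideanSpace ℝ (Fin d))))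
    (hΩ : IsEquiangular Ω (1 / ((i : ℝ) ^ 2 + 3 * i + 1)))
    (hS : SaturatesRelativeBound Ω (1 / ((i : ℝ) ^ 2 + 3 * i + 1))) : incoherence Ω < d := by
  classical
  obtain ⟨m, rfl⟩ : ∃ m, i = 8 * m + 4 := ⟨i / 8, by unfold Nat.ModEq at hi; omega⟩
  by_contra hlt
  obtain ⟨Γ, hΓΩ, hΓ, hcard⟩ := exists_isIncoherent_card_eq_incoherence Ω
  -- This rules out the alternative `Γ.card ≤ 2` in incoherence.
  have hd3 : 2 < d := by
    rw [hd]
    nlinarith [Nat.zero_le ((8 * m + 4) ^ 3), Nat.zero_le ((8 * m + 4) ^ 2)]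
  obtain ⟨v, hv, hvv⟩ := hΓ.exists_unit_vectors hΩ hΓΩ (by omega)
  have hex : ∀ L : Submodule ℝ (EuclideanSpace ℝ (Fin d)), ∃ u, L ∈ Ω → u ∈ L ∧ ‖u‖ = 1 :=
    fun L => by
      by_cases hL : L ∈ Ω
      · obtain ⟨u, hu⟩ := exists_unit_mem_of_finrank_eq_one (hΩ.isLine L hL)
        exact ⟨u, fun _ => hu⟩
      · exact ⟨0, fun h => absurd h hL⟩
  choose u hu using hex
  have hiR : (0 : ℝ) < ((8 * m + 4 : ℕ) : ℝ) := by positivity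
  have hli : LinearIndependent ℝ fun L : Γ => v L :=
    linearIndependent_of_equiangular (κ := 1 / (((8 * m + 4 : ℕ) : ℝ) ^ 2 + 3 * ((8 * m + 4 : ℕ) : ℝ) + 1))
      (by positivity) (by rw [div_lt_one (by positivity)]; nlinarith)
      (fun L => (hv L L.2).2) fun L M hLM => hvv L L.2 M M.2 fun h => hLM (Subtype.ext h)
  -- Linear independence bounds `Γ.card` by `d`; the negated conclusion gives the reverse
  -- inequality.
  have hΓd : Γ.card = d := by
    have h := hli.fintype_card_le_finrank
    rw [finrank_euclideanSpace_fin, Fintype.card_coe] at h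
    omega
  refine no_equiangular_tight_frame_with_positive_basis (P := Γ) (W := (Ω \ Γ : Finset _)) hd rfl
    (by rw [Fintype.card_coe, hΓd]) ?_ (fun L => v L) (fun L => u L) (fun L => (hv L L.2).2)
    (fun L => (hu L (Finset.mem_sdiff.mp L.2).1).2)
    (fun L M hLM => hvv L L.2 M M.2 fun h => hLM (Subtype.ext h)) (fun L M => ?_) fun L M hLM => ?_
  · rw [Fintype.card_coe, Fintype.card_coe, add_comm, Finset.card_sdiff_add_card_eq_card hΓΩ]
    exact hS.2
  · have hL := Finset.mem_sdiff.mp L.2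
    exact hΩ.angle L hL.1 M (hΓΩ M.2) (fun h => hL.2 (h ▸ M.2)) _ (hu L hL.1).1 _ (hv M M.2).1
      (hu L hL.1).2 (hv M M.2).2
  · have hL := (Finset.mem_sdiff.mp L.2).1
    have hM := (Finset.mem_sdiff.mp M.2).1
    exact hΩ.angle L hL M hM (fun h => hLM (Subtype.ext h)) _ (hu L hL).1 _ (hu M hM).1
      (hu L hL).2 (hu M hM).2

end Incoherence

theorem mainTheorem12 :
    (∀ i d k lam s₁ s₂ : ℕ, i ≡ 4 [MOD 8] → IsFamily1 i d k lam s₁ s₂ →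
      ∀ (P : Type*) [Fintype P] [DecidableEq P],
        ¬ ∃ B : Finset (Finset P), IsQuasiSymmetricDesign B 2 d k lam s₁ s₂) ∧
    (∀ i d k lam s₁ s₂ : ℕ, i ≡ 2 [MOD 4] → IsFamily2 i d k lam s₁ s₂ →
      ∀ (P : Type*) [Fintype P] [DecidableEq P],
        ¬ ∃ B : Finset (Finset P), IsQuasiSymmetricDesign B 2 d k lam s₁ s₂) ∧
    (∀ i d : ℕ, i ≡ 4 [MOD 8] → d = i * (i ^ 3 + 6 * i ^ 2 + 11 * i + 5) →
      ∀ Ω : Finset (Submodule ℝ (EuclideanSpace ℝ (Fin d))),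
        IsEquiangular Ω (1 / ((i : ℝ) ^ 2 + 3 * i + 1)) →
        SaturatesRelativeBound Ω (1 / ((i : ℝ) ^ 2 + 3 * i + 1)) →
        incoherence Ω < d) :=
  ⟨fun _ _ _ _ _ _ hi hF _ _ _ ⟨B, h⟩ => not_isQuasiSymmetricDesign_of_isFamily1 hi hF B h,
    fun _ _ _ _ _ _ hi hF _ _ _ ⟨B, h⟩ => not_isQuasiSymmetricDesign_of_isFamily2 hi hF B h,
    fun _ _ hi hd Ω hΩ hS => incoherence_lt_of_saturatesRelativeBound hi hd Ω hΩ hS⟩
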